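/- **Theorem (lower bound for counting cross inversions).** A *ranking* of a finite set $X$ of $n$ items is a bijection $\rho\colon X\to\{1,\dots,n\}$. In the comparison-query model, a (deterministic, adaptive) algorithm accesses the input ranking $\rho$ only through queries of the form "is $\rho(x_1)<\rho(x_2)$?" with $x_1,x_2\in X$. The query complexity $D(\Pi)$ of a function $\Pi$ on the rankings of $X$ is the minimum, over all algorithms that output $\Pi(\rho)$ on every input $\rho$, of the maximum number of queries made over all inputs $\rho$. There is a universal constant $c>0$ such that the following holds for all integers $1\le a\le b$ and every finite set $X=A\sqcup B$ that is the disjoint union of a set $A$ of size $a$ and a set $B$ of size $b$. 1. Let $\Pi_{\mathrm{XInv}}(\rho)$ be the number of cross inversions from $A$ to $B$ with respect to $\rho$, that is, the number of pairs $(x_1,x_2)\in A\times B$ with $\rho(x_1)>\rho(x_2)$. Then $$D(\Pi_{\mathrm{XInv}})\ \ge\ c\,(a+b)\log a .$$ 2. Let $T$ be the Mann–Whitney tree: the rooted tree whose root has exactly two children, one having the $a$ elements of $A$ as its children and the other having the $b$ elements of $B$ as its children, all of these elements being leaves. Let $\Pi_T(\rho)$ be the minimum, over all orderings of $T$ (an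 ordering of $T$ orders the children of every internal node), of the number of inversions with respect to $\rho$ of the left-to-right ranking $\sigma$ of the leaves induced by the ordering, i.e. of the number of pairs $(x_1,x_2)\in X\times X$ with $\rho(x_1)<\rho(x_2)$ and $\sigma(x_1)>\sigma(x_2)$. Then $$D(\Pi_T)\ \ge\ c\,(a+b)\log a .$$ -/

import Mathlib

namespace ComparisonQuery

/-! ### Rankings, inversions, cross inversions -/

/-- A ranking of a finite set `X` of `n` items: a bijection from `X` to the `n` ranks. -/
abbrev Ranking (X : Type*) [Fintype X] := X ≃ Fin (Fintype.card X)

/-- The number of inversions of the ranking `σ` with respect to the ranking `ρ`. -/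
def inversions {X : Type*} [Fintype X] (ρ σ : Ranking X) : ℕ :=
  (Finset.univ.filter fun p : X × X => ρ p.1 < ρ p.2 ∧ σ p.2 < σ p.1).card

/-- The number of cross inversions from `A` to `B` with respect to the ranking `ρ`. -/
def crossInversions {X : Type*} [Fintype X] (ρ : Ranking X) (A B : Finset X) : ℕ :=
  ((A ×ˢ B).filter fun p : X × X => ρ p.2 < ρ p.1).card

/-! ### The comparison-query model -/

/-- A deterministic (adaptive) algorithm in the comparison-query model: it either stops with an
output, or asks whether `x` has smaller rank than `y` and continues according to the answer
(first continuation: yes, second continuation: no). -/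
inductive Algorithm (X : Type*) (α : Type*) where
  | output : α → Algorithm X α
  | query : (x y : X) → Algorithm X α → Algorithm X α → Algorithm X α

namespace Algorithm

variable {X : Type*} [Fintype X] {α : Type*}

/-- The output of an algorithm on the input ranking `ρ`. -/
def run : Algorithm X α → Ranking X → α
  | output v, _ => v
  | query x y yes no, ρ => if ρ x < ρ y then yes.run ρ else no.run ρ

/-- The number of comparison queries that an algorithm makes on the input ranking `ρ`. -/
def queryCount : Algorithm X α → Ranking X → ℕ
  | output _, _ => 0
  | query x y yes no, ρ => 1 + if ρ x < ρ y then yes.queryCount ρ else no.queryCount ρ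

/-- The algorithm `M` solves the problem `P`, i.e. it outputs `P ρ` on every input `ρ`. -/
def Solves (M : Algorithm X α) (P : Ranking X → α) : Prop :=
  ∀ ρ : Ranking X, M.run ρ = P ρ

end Algorithm

/-- The (deterministic) query complexity of a computational problem `P`, a function on the
rankings of `X`: the least `q` such that some algorithm solves `P` with at most `q` queries
on every input ranking. -/
noncomputable def queryComplexity {X : Type*} [Fintype X] {α : Type*} (P : Ranking X → α) : ℕ :=
  sInf {q : ℕ | ∃ M : Algorithm X α, M.Solves P ∧ ∀ ρ : Ranking X, M.queryCount ρ ≤ q}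

/-! ### Rooted trees with labelled leaves, and inversion minimization -/

/-- Rooted trees whose leaves carry items of `X`; the children of a node are listed in some
initial order. -/
inductive LeafTree (X : Type*) where
  | leaf : X → LeafTree X
  | node : (k : ℕ) → (Fin k → LeafTree X) → LeafTree X

namespace LeafTree

variable {X : Type*}

/-- An ordering of a tree: an order of the children at every internal node. -/
def TreeOrdering : LeafTree X → Type
  | leaf _ => Unit
  | node k children => Equiv.Perm (Fin k) × ((i : Fin k) → (children i).TreeOrdering)

/-- The leaves of the ordered tree, listed from left to right; at a node ordered by `π`, the
child in position `i` is the one with initial index `π i`. -/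
def leafList : (T : LeafTree X) → T.TreeOrdering → List X
  | leaf x, _ => [x]
  | node _ children, (π, o) =>
      (List.ofFn fun i => (children (π i)).leafList (o (π i))).flatten

/-- The ranking `σ` is the left-to-right ranking of the leaves induced by the ordering `o`. -/
def Induces [Fintype X] (T : LeafTree X) (o : T.TreeOrdering) (σ : Ranking X) : Prop :=
  T.leafList o = List.ofFn σ.symm

/-- Inversion minimization on the fixed tree `T` (with leaf set `X`): the minimum number of
inversions with respect to the input `ρ` of the left-to-right ranking of the leaves, over all
orderings of `T`. -/
noncomputable def minInversions [Fintype X] (T : LeafTree X) (ρ : Ranking X) : ℕ :=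
  sInf {m : ℕ | ∃ (o : T.TreeOrdering) (σ : Ranking X), T.Induces o σ ∧ inversions ρ σ = m}

/-- A node all of whose children are leaves, carrying the items of `A`. -/
noncomputable def star (A : Finset X) : LeafTree X :=
  node A.card fun i => leaf (A.equivFin.symm i : X)

/-- The Mann–Whitney tree: the root has two children, one of which has the items of `A` as its
children, and the other the items of `B`. -/
noncomputable def mannWhitney (A B : Finset X) : LeafTree X :=
  node 2 ![star A, star B]

end LeafTree

end ComparisonQuery

namespace ComparisonQuery

/-- Rankings that agree on all comparisons are equal. -/
theorem Ranking.eq_of_lt_iff {X : Type*} [Fintype X] {ρ σ : Ranking X}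
    (h : ∀ x y, ρ x < ρ y ↔ σ x < σ y) : ρ = σ := by
  have hm : StrictMono (ρ.symm.trans σ) := by
    intro i j hij
    have := (h (ρ.symm i) (ρ.symm j)).1 (by simpa using hij)
    simpa using this
  have he : (hm.orderIsoOfSurjective _ (ρ.symm.trans σ).surjective) = OrderIso.refl _ :=
    Subsingleton.elim _ _
  ext x
  have := congrArg (fun e : _ ≃o _ => e (ρ x)) he
  simp at this
  rw [this]

/-- Every problem is solved by some algorithm. -/
theorem Algorithm.exists_solves {X : Type*} [Fintype X] {α : Type*} (P : Ranking X → α) :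
    ∃ M : Algorithm X α, M.Solves P := by
  classical
  have key : ∀ (n : ℕ) (S : Finset (Ranking X)), S.card ≤ n →
      ∃ M : Algorithm X α, ∀ ρ ∈ S, M.run ρ = P ρ := by
    intro n
    induction n with
    | zero =>
      intro S hS
      refine ⟨.output (P (Fintype.equivFin X)), fun ρ hρ => ?_⟩
      simp [Finset.card_eq_zero.1 (Nat.le_zero.1 hS)] at hρ
    | succ n ih =>
      intro S hS
      by_cases hc : S.card ≤ 1
      · rcases S.eq_empty_or_nonempty with rfl | ⟨σ, hσ⟩
        · exact ih _ (by simp)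
        · exact ⟨.output (P σ), fun ρ hρ => by
            rw [Finset.card_le_one.1 hc ρ hρ σ hσ]; rfl⟩
      · obtain ⟨ρ, hρ, σ, hσ, hne⟩ := Finset.one_lt_card.1 (not_le.1 hc)
        have hxy : ∃ x y, ¬ (ρ x < ρ y ↔ σ x < σ y) := by
          by_contra! hcon
          exact hne (Ranking.eq_of_lt_iff hcon)
        obtain ⟨x, y, hxy⟩ := hxy
        have h1 : (S.filter fun τ => τ x < τ y).card < S.card := by
          apply Finset.card_lt_card
          rw [Finset.filter_ssubset]
          by_cases hh : ρ x < ρ y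
          · exact ⟨σ, hσ, by tauto⟩
          · exact ⟨ρ, hρ, hh⟩
        have h2 : (S.filter fun τ => ¬ τ x < τ y).card < S.card := by
          apply Finset.card_lt_card
          rw [Finset.filter_ssubset]
          by_cases hh : ρ x < ρ y
          · exact ⟨ρ, hρ, by tauto⟩
          · exact ⟨σ, hσ, by tauto⟩
        obtain ⟨M1, hM1⟩ := ih _ (by omega : (S.filter fun τ => τ x < τ y).card ≤ n)
        obtain ⟨M2, hM2⟩ := ih _ (by omega : (S.filter fun τ => ¬ τ x < τ y).card ≤ n)
        refine ⟨.query x y M1 M2, fun τ hτ => ?_⟩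
        by_cases hh : τ x < τ y
        · simpa [Algorithm.run, hh] using hM1 τ (by simp [hτ, hh])
        · simpa [Algorithm.run, hh] using hM2 τ (by simpa [hτ] using hh)
  obtain ⟨M, hM⟩ := key _ Finset.univ le_rfl
  exact ⟨M, fun ρ => hM ρ (Finset.mem_univ ρ)⟩

/-- The minimum in the definition of the query complexity is attained. -/
theorem exists_algorithm_queryComplexity {X : Type*} [Fintype X] {α : Type*}
    (P : Ranking X → α) :
    ∃ M : Algorithm X α, M.Solves P ∧ ∀ ρ : Ranking X, M.queryCount ρ ≤ queryComplexity P := by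
  classical
  obtain ⟨M, hM⟩ := Algorithm.exists_solves P
  exact Nat.sInf_mem (s := {q : ℕ | ∃ M : Algorithm X α, M.Solves P ∧
    ∀ ρ : Ranking X, M.queryCount ρ ≤ q})
    ⟨Finset.univ.sup M.queryCount, M, hM, fun ρ => Finset.le_sup (Finset.mem_univ ρ)⟩

namespace LeafTree

/-- All orderings of a tree list the same leaves. -/
theorem leafList_perm {X : Type*} (T : LeafTree X) (o o' : T.TreeOrdering) :
    (T.leafList o).Perm (T.leafList o') := by
  induction T with
  | leaf x => exact List.Perm.refl _
  | node k children ih =>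
    obtain ⟨π, o⟩ := o
    obtain ⟨π', o'⟩ := o'
    have h : ∀ (π : Equiv.Perm (Fin k)) (o : (i : Fin k) → (children i).TreeOrdering),
        ((List.ofFn fun i => (children (π i)).leafList (o (π i))).flatten).Perm
          (List.ofFn fun i => (children i).leafList (o i)).flatten := by
      intro π o
      exact (Equiv.Perm.ofFn_comp_perm π fun i => (children i).leafList (o i)).flatten
    refine (h π o).trans (List.Perm.trans ?_ (h π' o').symm)
    refine List.Perm.flatten_congr ?_
    rw [List.forall₂_iff_get]
    refine ⟨by simp, fun i h1 h2 => ?_⟩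
    simpa using ih _ _ _

end LeafTree
end ComparisonQuery


namespace ComparisonQuery
namespace LeafTree

/-- Some ordering of the tree exists. -/
theorem nonempty_treeOrdering {X : Type*} (T : LeafTree X) : Nonempty T.TreeOrdering := by
  induction T with
  | leaf x => exact ⟨()⟩
  | node k children ih => exact ⟨(1, fun i => (ih i).some)⟩

/-- If `A` and `B` partition `X`, every ordering of the Mann–Whitney tree induces a ranking. -/
theorem exists_induces_mannWhitney {X : Type*} [Fintype X] [DecidableEq X] {A B : Finset X}
    (hd : Disjoint A B) (hu : A ∪ B = Finset.univ) (o : (mannWhitney A B).TreeOrdering) :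
    ∃ σ : Ranking X, (mannWhitney A B).Induces o σ := by
  have hs : ∀ (S : Finset X) (o : (star S).TreeOrdering), ((star S).leafList o).Perm S.toList := by
    intro S o
    have h0 : (star S).leafList (1, fun _ => ()) =
        List.ofFn fun i => (S.equivFin.symm i : X) := by
      simp only [star, leafList, Equiv.Perm.coe_one, id]
      rw [List.ofFn_eq_map, List.ofFn_eq_map]
      induction List.finRange S.card with
      | nil => rfl
      | cons a l ih => simp [ih]
    refine (leafList_perm _ o (1, fun _ => ())).trans ?_
    have hn : (List.ofFn fun i => (S.equivFin.symm i : X)).Nodup :=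
      List.nodup_ofFn.2 (Subtype.val_injective.comp S.equivFin.symm.injective)
    rw [h0, List.perm_ext_iff_of_nodup hn S.nodup_toList]
    intro x
    simp only [List.mem_ofFn, Finset.mem_toList]
    exact ⟨fun ⟨i, hi⟩ => hi ▸ (S.equivFin.symm i).2,
      fun hx => ⟨S.equivFin ⟨x, hx⟩, by simp⟩⟩
  have hp : ((mannWhitney A B).leafList o).Perm (A.toList ++ B.toList) := by
    obtain ⟨oA⟩ := nonempty_treeOrdering (star A)
    obtain ⟨oB⟩ := nonempty_treeOrdering (star B)
    refine (leafList_perm _ o (1, Fin.cons oA (Fin.cons oB finZeroElim))).trans ?_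
    have : (mannWhitney A B).leafList (1, Fin.cons oA (Fin.cons oB finZeroElim)) =
        (star A).leafList oA ++ ((star B).leafList oB ++ []) := rfl
    rw [this, List.append_nil]
    exact (hs A oA).append (hs B oB)
  have hnd : ((mannWhitney A B).leafList o).Nodup := by
    rw [hp.nodup_iff, List.nodup_append]
    refine ⟨A.nodup_toList, B.nodup_toList, fun x hx y hy hxy => ?_⟩
    subst hxy
    exact Finset.disjoint_left.1 hd (Finset.mem_toList.1 hx) (Finset.mem_toList.1 hy)
  have hmem : ∀ x, x ∈ (mannWhitney A B).leafList o := by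
    intro x
    rw [hp.mem_iff, List.mem_append, Finset.mem_toList, Finset.mem_toList, ← Finset.mem_union, hu]
    exact Finset.mem_univ x
  have hlen : ((mannWhitney A B).leafList o).length = Fintype.card X := by
    rw [hp.length_eq, List.length_append, Finset.length_toList, Finset.length_toList,
      ← Finset.card_union_of_disjoint hd, hu, Finset.card_univ]
  refine ⟨(((finCongr hlen).symm.trans (hnd.getEquivOfForallMemList _ hmem))).symm, ?_⟩
  refine List.ext_get (by simpa using hlen) fun i h1 h2 => ?_
  simp [List.Nodup.getEquivOfForallMemList]

end LeafTree
end ComparisonQuery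

namespace ComparisonQuery

/-! Fix an order of A and place each item of B in one of the first ⌊a/2⌋ + 1 gaps of that order.
This gives (⌊a/2⌋ + 1)^b rankings, and any two of them disagree on some pair in A × B. An algorithm
making at most q queries has at most 2^q leaves, so if the family is larger, two of its members end
at the same leaf (`Algorithm.exists_same_leaf`).

The comparisons at that leaf leave some x ∈ A and y ∈ B incomparable, so there are two compatible
rankings that differ only in the order of x and y (`Ranking.exists_adjacent`). Their numbers of
cross inversions differ by 1, although the outputs agree. This refutes an algorithm for cross
inversions.

The tree problem computes min(c, ab - c), where c is the number of cross inversions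
(`minInversions_mannWhitney`). It takes equal values at c and c + 1 only if 2c + 1 = ab. The family
avoids this midpoint: using only half of the gaps keeps its cross inversions at most ⌊a/2⌋b. Hence
2^q ≥ (⌊a/2⌋ + 1)^b in both cases. -/

variable {X : Type*} [Fintype X]

/-! ### Leaves of decision trees and linear extensions -/

/-- An injective map to a linear order induces a ranking. -/
theorem Ranking.exists_lt_iff {β : Type*} [LinearOrder β] (f : X → β)
    (hf : Function.Injective f) : ∃ τ : Ranking X, ∀ u v, τ u < τ v ↔ f u < f v := by
  classical
  have hc : (Finset.univ.image f).card = Fintype.card X := by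
    rw [Finset.card_image_of_injective _ hf, Finset.card_univ]
  let e := (Finset.univ.image f).orderIsoOfFin hc
  let g : X → Fin (Fintype.card X) := fun x => e.symm ⟨f x, by simp⟩
  have hg : ∀ u v, g u < g v ↔ f u < f v := fun u v => by simp [g]
  have hinj : Function.Injective g := fun u v h => by
    simpa [g, hf.eq_iff] using h
  refine ⟨Equiv.ofBijective g ?_, hg⟩
  rw [Fintype.bijective_iff_injective_and_card]
  exact ⟨hinj, by simp⟩

/-- If more than `2 ^ q` rankings are each handled with at most `q` queries, then two of them
end at the same leaf, which is described by the set `R` of comparisons made. -/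
theorem Algorithm.exists_same_leaf {α : Type*} (M : Algorithm X α) :
    ∀ (q : ℕ) (F : Finset (Ranking X)), (∀ ρ ∈ F, M.queryCount ρ ≤ q) → 2 ^ q < F.card →
      ∃ ρ ∈ F, ∃ σ ∈ F, ρ ≠ σ ∧ ∃ R : Set (X × X),
        (∀ p ∈ R, ρ p.1 < ρ p.2) ∧ (∀ p ∈ R, σ p.1 < σ p.2) ∧
        ∀ τ : Ranking X, (∀ p ∈ R, τ p.1 < τ p.2) → M.run τ = M.run ρ := by
  classical
  induction M with
  | output v =>
    intro q F _ hF
    obtain ⟨ρ, hρ, σ, hσ, hne⟩ := Finset.one_lt_card.1 (Nat.one_le_two_pow.trans_lt hF)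
    exact ⟨ρ, hρ, σ, hσ, hne, ∅, by simp, by simp, fun _ _ => rfl⟩
  | query x y yes no ihy ihn =>
    intro q F hq hF
    cases q with
    | zero =>
      obtain ⟨ρ, hρ⟩ := Finset.card_pos.1 ((Nat.zero_le _).trans_lt hF)
      have := hq ρ hρ
      simp [queryCount] at this
    | succ q =>
      have hsplit := Finset.card_filter_add_card_filter_not (s := F) (fun τ => τ x < τ y)
      rcases lt_or_ge (2 ^ q) (F.filter fun τ => τ x < τ y).card with h | h
      · obtain ⟨ρ, hρ, σ, hσ, hne, R, h1, h2, h3⟩ := ihy q _ (fun τ hτ => by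
          have hm := Finset.mem_filter.1 hτ
          have := hq τ hm.1
          simp only [queryCount, hm.2, if_true] at this
          omega) h
        rw [Finset.mem_filter] at hρ hσ
        refine ⟨ρ, hρ.1, σ, hσ.1, hne, insert (x, y) R, ?_, ?_, fun τ hτ => ?_⟩
        · simpa only [Set.forall_mem_insert] using ⟨hρ.2, h1⟩
        · simpa only [Set.forall_mem_insert] using ⟨hσ.2, h2⟩
        · rw [Set.forall_mem_insert] at hτ
          simpa only [run, hτ.1, hρ.2, if_true] using h3 τ hτ.2
      · obtain ⟨ρ, hρ, σ, hσ, hne, R, h1, h2, h3⟩ :=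
          ihn q (F.filter fun τ => ¬ τ x < τ y) (fun τ hτ => by
            have hm := Finset.mem_filter.1 hτ
            have := hq τ hm.1
            simp only [queryCount, hm.2, if_false] at this
            omega) (by rw [pow_succ] at hF; omega)
        rw [Finset.mem_filter] at hρ hσ
        -- A query with x = y is always answered "no" and imposes no constraint, so `R` stays as it
        -- is.
        by_cases hxy : x = y
        · subst hxy
          exact ⟨ρ, hρ.1, σ, hσ.1, hne, R, h1, h2, fun τ hτ => by simpa [run] using h3 τ hτ⟩
        · have hlt : ∀ τ : Ranking X, ¬ τ x < τ y → τ y < τ x := fun τ h =>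
            lt_of_le_of_ne (not_lt.1 h) fun h' => hxy (τ.injective h').symm
          refine ⟨ρ, hρ.1, σ, hσ.1, hne, insert (y, x) R, ?_, ?_, fun τ hτ => ?_⟩
          · simpa only [Set.forall_mem_insert] using ⟨hlt ρ hρ.2, h1⟩
          · simpa only [Set.forall_mem_insert] using ⟨hlt σ hσ.2, h2⟩
          · rw [Set.forall_mem_insert] at hτ
            simpa only [run, hτ.1.not_gt, hρ.2, if_false] using h3 τ hτ.2

/-- If two rankings satisfying the comparisons in `R` disagree on `x` and `y`, then there are two
rankings satisfying `R` that disagree on `x` and `y` only. -/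
theorem Ranking.exists_adjacent {R : Set (X × X)} {ρ σ : Ranking X}
    (hρ : ∀ p ∈ R, ρ p.1 < ρ p.2) (hσ : ∀ p ∈ R, σ p.1 < σ p.2) {x y : X}
    (hxy : ρ x < ρ y) (hyx : σ y < σ x) :
    ∃ τ τ' : Ranking X, (∀ p ∈ R, τ p.1 < τ p.2) ∧ (∀ p ∈ R, τ' p.1 < τ' p.2) ∧
      τ x < τ y ∧ τ' y < τ' x ∧
      ∀ u v, (u, v) ≠ (x, y) → (u, v) ≠ (y, x) → (τ u < τ v ↔ τ' u < τ' v) := by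
  classical
  -- The partial order generated by `R`. Both rankings extend it and they disagree on x and y, so x
  -- and y are incomparable.
  let S : X → X → Prop := Relation.TransGen fun u v => (u, v) ∈ R
  have hS : ∀ {θ : Ranking X}, (∀ p ∈ R, θ p.1 < θ p.2) → ∀ {u v}, S u v → θ u < θ v := by
    intro θ hθ u v h
    induction h with
    | single h => exact hθ _ h
    | tail _ h ih => exact ih.trans (hθ _ h)
  have hne : x ≠ y := fun h => by simp [h] at hxy
  have nxx : ¬ S x x := fun h => (hS hρ h).false
  have nyy : ¬ S y y := fun h => (hS hρ h).false
  have nxy : ¬ S x y := fun h => (hS hσ h).asymm hyx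
  have nyx : ¬ S y x := fun h => (hS hρ h).asymm hxy
  -- Three levels: the items below x or y, then x and y themselves, then the rest. Relations of `R`
  -- never go down a level, and none lies within the middle one.
  let k : X → ℕ := fun z => if S z x ∨ S z y then 0 else if z = x ∨ z = y then 1 else 2
  have kx : k x = 1 := by simp [k, nxx, nxy]
  have ky : k y = 1 := by simp [k, nyy, nyx]
  have k1 : ∀ {z}, k z = 1 → z = x ∨ z = y := fun {z} h => by
    by_contra hz
    by_cases hs : S z x ∨ S z y <;> simp [k, hs, hz] at h
  have kR : ∀ {u v}, (u, v) ∈ R → k u < k v ∨ k u = k v ∧ k u ≠ 1 := by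
    intro u v h
    have huv : S u v := .single h
    by_cases hu : S u x ∨ S u y
    · have h0 : k u = 0 := by simp [k, hu]
      omega
    · have hv : ¬ (S v x ∨ S v y) := fun hv => hu (hv.imp huv.trans huv.trans)
      have hv' : ¬ (v = x ∨ v = y) := by
        rintro (rfl | rfl)
        · exact hu (.inl huv)
        · exact hu (.inr huv)
      have h2 : k v = 2 := by simp [k, hv, hv']
      have : k u = 1 ∨ k u = 2 := by
        by_cases hu' : u = x ∨ u = y
        · exact .inl (by simp [k, hu, hu'])
        · exact .inr (by simp [k, hu, hu'])
      omega
  -- Sorting by level, with ties broken by `ρ` or by `ρ'`, gives two rankings that differ only on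
  -- the middle level.
  let ρ' : Ranking X := (Equiv.swap x y).trans ρ
  have key : ∀ θ : Ranking X, ∃ τ : Ranking X,
      ∀ u v, τ u < τ v ↔ k u < k v ∨ k u = k v ∧ θ u < θ v := by
    intro θ
    obtain ⟨τ, hτ⟩ := Ranking.exists_lt_iff (fun u => toLex (k u, θ u)) fun u v h => by
      have := congrArg (fun p => (ofLex p).2) h
      exact θ.injective this
    exact ⟨τ, fun u v => (hτ u v).trans (by simp [Prod.Lex.lt_iff])⟩
  have hk : ∀ {u v}, k u ≠ 1 → k u = k v → (ρ u < ρ v ↔ ρ' u < ρ' v) := by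
    intro u v h h'
    have e : ∀ {z}, k z ≠ 1 → ρ' z = ρ z := fun {z} hz => by
      have h1 : z ≠ x := fun h => hz (h ▸ kx)
      have h2 : z ≠ y := fun h => hz (h ▸ ky)
      simp [ρ', Equiv.swap_apply_of_ne_of_ne h1 h2]
    rw [e h, e (h' ▸ h)]
  obtain ⟨τ, hτ⟩ := key ρ
  obtain ⟨τ', hτ'⟩ := key ρ'
  refine ⟨τ, τ', fun p hp => ?_, fun p hp => ?_, ?_, ?_, fun u v h1 h2 => ?_⟩
  · exact (hτ _ _).2 ((kR hp).imp_right fun h => ⟨h.1, hρ _ hp⟩)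
  · exact (hτ' _ _).2 ((kR hp).imp_right fun h => ⟨h.1, (hk h.2 h.1).1 (hρ _ hp)⟩)
  · exact (hτ _ _).2 (.inr ⟨kx.trans ky.symm, hxy⟩)
  · exact (hτ' _ _).2 (.inr ⟨ky.trans kx.symm, by simpa [ρ'] using hxy⟩)
  · rw [hτ, hτ']
    refine or_congr_right (and_congr_right fun h => ?_)
    by_cases hu : k u = 1
    · rcases k1 hu with rfl | rfl <;> rcases k1 (h ▸ hu) with rfl | rfl
      exacts [by simp, absurd rfl h1, absurd rfl h2, by simp]
    · exact hk hu h

/-! ### Cross inversions and the family of gap rankings -/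

section Family

variable {A B : Finset X}

/-- Each pair in `A × B` is a cross inversion in exactly one of the two directions. -/
theorem crossInversions_add_crossInversions (hd : Disjoint A B) (ρ : Ranking X) :
    crossInversions ρ A B + crossInversions ρ B A = A.card * B.card := by
  rw [← Finset.card_product, ← Finset.card_filter_add_card_filter_not (s := A ×ˢ B)
    (fun p : X × X => ρ p.2 < ρ p.1), crossInversions, crossInversions]
  congr 1
  refine Finset.card_bij (fun p _ => p.swap) ?_ (fun _ _ _ _ h => Prod.swap_injective h) ?_
  · rintro ⟨u, v⟩ h
    simp only [Finset.mem_filter, Finset.mem_product] at h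
    simpa [h.1.1, h.1.2] using h.2.le
  · rintro ⟨u, v⟩ h
    simp only [Finset.mem_filter, Finset.mem_product, not_lt] at h
    refine ⟨(v, u), ?_, rfl⟩
    simp only [Finset.mem_filter, Finset.mem_product]
    refine ⟨h.1.symm, lt_of_le_of_ne h.2 fun e => ?_⟩
    exact Finset.disjoint_left.1 hd h.1.1 (ρ.injective e ▸ h.1.2)

/-- If `σ` lists `A` before `B`, the cross inversions of `ρ` are inversions. -/
theorem crossInversions_le_inversions {ρ σ : Ranking X}
    (h : ∀ x ∈ A, ∀ y ∈ B, σ x < σ y) : crossInversions ρ A B ≤ inversions ρ σ := by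
  refine Finset.card_le_card_of_injOn Prod.swap ?_ Prod.swap_injective.injOn
  rintro ⟨u, v⟩ hp
  simp only [Finset.coe_filter, Finset.mem_product, Set.mem_ofPred_eq] at hp
  simpa using ⟨hp.2, h u hp.1.1 v hp.1.2⟩

variable [DecidableEq X]

theorem crossInversions_eq_add_one (hd : Disjoint A B) {τ τ' : Ranking X} {x y : X}
    (hx : x ∈ A) (hy : y ∈ B) (h : τ x < τ y) (h' : τ' y < τ' x)
    (hτ : ∀ u v, (u, v) ≠ (x, y) → (u, v) ≠ (y, x) → (τ u < τ v ↔ τ' u < τ' v)) :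
    crossInversions τ' A B = crossInversions τ A B + 1 := by
  have hns : (x, y) ∉ (A ×ˢ B).filter fun p : X × X => τ p.2 < τ p.1 := by
    simp [h.le]
  rw [crossInversions, crossInversions, ← Finset.card_insert_of_notMem hns]
  congr 1
  ext ⟨u, v⟩
  simp only [Finset.mem_filter, Finset.mem_product, Finset.mem_insert]
  by_cases huv : (u, v) = (x, y)
  · obtain ⟨rfl, rfl⟩ := Prod.mk.inj huv
    simp [hx, hy, h']
  · simp only [huv, false_or]
    refine and_congr_right fun hm => (hτ v u ?_ ?_).symm
    · rintro ⟨⟩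
      exact Finset.disjoint_left.1 hd hx hm.2
    · rintro ⟨⟩
      exact huv rfl

/-- For any choice of gaps `g y` between the items of `A`, some ranking puts exactly the items of
`A` with index less than `g y` after `y`. -/
theorem exists_ranking_of_gaps (hd : Disjoint A B) (g : X → ℕ) :
    ∃ τ : Ranking X, ∀ x (hx : x ∈ A), ∀ y ∈ B, τ y < τ x ↔ (A.equivFin ⟨x, hx⟩ : ℕ) < g y := by
  -- Items of A sit at even positions, in decreasing order of index; items of B sit at odd positions
  -- between them. Items of B in the same gap are separated by the tie-break below.
  let f : X → ℤ := fun z => if hz : z ∈ A then -2 * (A.equivFin ⟨z, hz⟩ : ℕ) else -2 * g z + 1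
  obtain ⟨τ, hτ⟩ := Ranking.exists_lt_iff (fun z => toLex (f z, Fintype.equivFin X z))
    fun u v h => (Fintype.equivFin X).injective (congrArg (fun p => (ofLex p).2) h)
  refine ⟨τ, fun x hx y hy => ?_⟩
  have hy' : y ∉ A := fun h => Finset.disjoint_left.1 hd h hy
  rw [hτ, Prod.Lex.lt_iff]
  simp only [f, ofLex_toLex, hx, hy', dif_pos, dif_neg, not_false_iff]
  omega

/-- A problem whose value changes with the number of cross inversions, except possibly halfway
between its extremes, has at least `(a / 2 + 1) ^ b` leaves in each of its decision trees. -/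
theorem pow_le_two_pow_queryComplexity {α : Type*} (hd : Disjoint A B) (hA : 2 ≤ A.card)
    (hB : 2 ≤ B.card) (P : Ranking X → α)
    (hP : ∀ ρ ρ' σ : Ranking X, crossInversions ρ' A B = crossInversions ρ A B + 1 →
      P ρ = P ρ' → P ρ = P σ →
      Odd (A.card * B.card) ∧ A.card * B.card ≤ 2 * crossInversions σ A B + 1) :
    (A.card / 2 + 1) ^ B.card ≤ 2 ^ queryComplexity P := by
  obtain ⟨M, hM, hq⟩ := exists_algorithm_queryComplexity P
  let ext : (B → Fin (A.card / 2 + 1)) → X → ℕ := fun g z => if hz : z ∈ B then g ⟨z, hz⟩ else 0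
  choose τ hτ using fun g : B → Fin (A.card / 2 + 1) => exists_ranking_of_gaps hd (ext g)
  have hext : ∀ g z, ext g z ≤ A.card / 2 := fun g z => by
    by_cases hz : z ∈ B
    · simpa [ext, hz] using Nat.lt_succ_iff.1 (g ⟨z, hz⟩).2
    · simp [ext, hz]
  have hsep : ∀ g g', g ≠ g' → ∃ x ∈ A, ∃ y ∈ B,
      (τ g x < τ g y ∧ τ g' y < τ g' x) ∨ (τ g' x < τ g' y ∧ τ g y < τ g x) := by
    intro g g' hne
    obtain ⟨⟨y, hy⟩, hgy⟩ := Function.ne_iff.1 hne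
    have hlt : ∀ (g : B → Fin (A.card / 2 + 1)) {x : X} (hx : x ∈ A),
        ext g y ≤ (A.equivFin ⟨x, hx⟩ : ℕ) → τ g x < τ g y := by
      intro g x hx h
      refine lt_of_le_of_ne (not_lt.1 fun h' => ?_) fun h' => ?_
      · exact absurd ((hτ g x hx y hy).1 h') (not_lt.2 h)
      · exact Finset.disjoint_left.1 hd hx ((τ g).injective h' ▸ hy)
    have hne' : ext g y ≠ ext g' y := by simpa [ext, hy, Fin.ext_iff] using hgy
    have main : ∀ g g' : B → Fin (A.card / 2 + 1), ext g y < ext g' y →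
        ∃ x ∈ A, τ g x < τ g y ∧ τ g' y < τ g' x := by
      intro g g' h
      -- The item whose index is the smaller gap value precedes y under `g` and follows it under
      -- `g'`.
      let x := A.equivFin.symm ⟨ext g y, by have := hext g' y; omega⟩
      refine ⟨x, x.2, hlt g x.2 (by simp [x]), (hτ g' x x.2 y hy).2 (by simpa [x] using h)⟩
    rcases hne'.lt_or_gt with h | h
    · obtain ⟨x, hx, h⟩ := main g g' h
      exact ⟨x, hx, y, hy, .inl h⟩
    · obtain ⟨x, hx, h⟩ := main g' g h
      exact ⟨x, hx, y, hy, .inr h⟩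
  have hinj : Function.Injective τ := by
    intro g g' h
    by_contra hne
    obtain ⟨x, -, y, -, h' | h'⟩ := hsep g g' hne <;> rw [h] at h' <;>
      exact h'.1.asymm h'.2
  have hcross : ∀ g, crossInversions (τ g) A B ≤ A.card / 2 * B.card := by
    intro g
    have : ((A ×ˢ B).filter fun p : X × X => τ g p.2 < τ g p.1).card ≤
        (Finset.range (A.card / 2) ×ˢ B).card := by
      refine Finset.card_le_card_of_injOn
        (fun p => (if hp : p.1 ∈ A then (A.equivFin ⟨p.1, hp⟩ : ℕ) else 0, p.2)) ?_ ?_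
      · rintro ⟨u, v⟩ h
        simp only [Finset.coe_filter, Finset.mem_product, Set.mem_ofPred_eq] at h
        have := (hτ g u h.1.1 v h.1.2).1 h.2
        have := hext g v
        simp only [Finset.coe_product, Set.mem_prod, Finset.mem_coe, Finset.mem_range, h.1.1,
          h.1.2, dif_pos, and_true]
        omega
      · rintro ⟨u, v⟩ h ⟨u', v'⟩ h' he
        simp only [Finset.coe_filter, Finset.mem_product, Set.mem_ofPred_eq] at h h'
        simpa [h.1.1, h'.1.1, Fin.ext_iff.symm] using he
    simpa [crossInversions] using this
  by_contra! hlt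
  obtain ⟨ρ, hρ, σ, hσ, hne, R, h1, h2, h3⟩ := M.exists_same_leaf (queryComplexity P)
    (Finset.univ.image τ) (fun ρ _ => hq ρ)
    (by rw [Finset.card_image_of_injective _ hinj]; simpa using hlt)
  simp only [Finset.mem_image, Finset.mem_univ, true_and] at hρ hσ
  obtain ⟨g, rfl⟩ := hρ
  obtain ⟨g', rfl⟩ := hσ
  obtain ⟨x, hx, y, hy, h⟩ := hsep g g' fun h => hne (h ▸ rfl)
  obtain ⟨θ, θ', hθ, hθ', hxy, hyx, ho⟩ := h.elim
    (fun h => Ranking.exists_adjacent h1 h2 h.1 h.2)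
    (fun h => Ranking.exists_adjacent h2 h1 h.1 h.2)
  have e := h3 θ hθ
  have e' := h3 θ' hθ'
  rw [hM, hM] at e e'
  obtain ⟨hodd, hle⟩ := hP θ θ' (τ g) (crossInversions_eq_add_one hd hx hy hxy hyx ho)
    (e.trans e'.symm) e
  -- With a = 2m + 1, the bound c ≤ mb gives 2c + 1 ≤ ab - b + 1 < ab since b ≥ 2, which contradicts
  -- `hle`.
  obtain ⟨m, hm⟩ := (Nat.odd_mul.1 hodd).1
  have hc := hcross g
  have hm2 : A.card / 2 = m := by omega
  rw [hm2] at hc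
  rw [hm] at hle
  nlinarith

/-- If `σ` lists `A` before `B` and agrees with `ρ` on `A` and on `B`, then there are no
inversions except the cross inversions. -/
theorem inversions_le_crossInversions (hu : A ∪ B = Finset.univ) {ρ σ : Ranking X}
    (h : ∀ x ∈ A, ∀ y ∈ B, σ x < σ y)
    (hA : ∀ x ∈ A, ∀ y ∈ A, ρ x < ρ y → σ x < σ y)
    (hB : ∀ x ∈ B, ∀ y ∈ B, ρ x < ρ y → σ x < σ y) :
    inversions ρ σ ≤ crossInversions ρ A B := by
  refine Finset.card_le_card_of_injOn Prod.swap ?_ Prod.swap_injective.injOn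
  rintro ⟨u, v⟩ hp
  simp only [Finset.coe_filter, Finset.mem_univ, true_and, Set.mem_ofPred_eq] at hp
  have mem : ∀ z, z ∈ A ∨ z ∈ B := fun z => by
    rw [← Finset.mem_union, hu]; exact Finset.mem_univ z
  have key : u ∈ B ∧ v ∈ A := by
    rcases mem u with h1 | h1 <;> rcases mem v with h2 | h2
    · exact absurd (hA _ h1 _ h2 hp.1) hp.2.not_gt
    · exact absurd (h _ h1 _ h2) hp.2.not_gt
    · exact ⟨h1, h2⟩
    · exact absurd (hB _ h1 _ h2 hp.1) hp.2.not_gt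
  simpa [key.1, key.2] using hp.1

end Family

/-! ### Inversion minimization on the Mann–Whitney tree -/

namespace LeafTree

theorem leafList_star {Y : Type*} (S : Finset Y) (o : (star S).TreeOrdering) :
    (star S).leafList o = List.ofFn fun i => (S.equivFin.symm (o.1 i) : Y) := by
  have h : (star S).leafList o =
      (List.ofFn fun i => [(S.equivFin.symm (o.1 i) : Y)]).flatten := rfl
  rw [h, List.ofFn_eq_map, List.ofFn_eq_map]
  induction List.finRange S.card with
  | nil => rfl
  | cons a l ih => simp [ih]

theorem mem_leafList_star {Y : Type*} {S : Finset Y} (o : (star S).TreeOrdering) {x : Y} :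
    x ∈ (star S).leafList o ↔ x ∈ S := by
  rw [leafList_star, List.mem_ofFn]
  refine ⟨fun ⟨i, hi⟩ => hi ▸ (S.equivFin.symm (o.1 i)).2, fun hx => ?_⟩
  exact ⟨o.1.symm (S.equivFin ⟨x, hx⟩), by simp⟩

theorem exists_sorted_star (S : Finset X) (ρ : Ranking X) :
    ∃ o : (star S).TreeOrdering, ((star S).leafList o).Pairwise fun u v => ρ u < ρ v := by
  let f : Fin S.card → Fin (Fintype.card X) := fun i => ρ (S.equivFin.symm i)
  let o : (star S).TreeOrdering := (Tuple.sort f, fun _ => ())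
  have ho : (star S).leafList o = List.ofFn fun i => (S.equivFin.symm (Tuple.sort f i) : X) :=
    leafList_star S o
  refine ⟨o, ?_⟩
  rw [ho, List.pairwise_ofFn]
  intro i j hij
  refine lt_of_le_of_ne (Tuple.monotone_sort f hij.le) fun h => hij.ne ?_
  simpa using h

theorem leafList_mannWhitney {Y : Type*} (A B : Finset Y) (o : (mannWhitney A B).TreeOrdering) :
    ∃ (oA : (star A).TreeOrdering) (oB : (star B).TreeOrdering),
      (mannWhitney A B).leafList o = (star A).leafList oA ++ (star B).leafList oB ∨
      (mannWhitney A B).leafList o = (star B).leafList oB ++ (star A).leafList oA := by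
  obtain ⟨π, o⟩ := o
  refine ⟨o 0, o 1, ?_⟩
  have h : (mannWhitney A B).leafList (π, o) =
      (![star A, star B] (π 0)).leafList (o (π 0)) ++
        ((![star A, star B] (π 1)).leafList (o (π 1)) ++ []) := rfl
  rw [h, List.append_nil]
  have h01 : π 0 ≠ π 1 := π.injective.ne (by decide)
  obtain ⟨h0, h1⟩ | ⟨h0, h1⟩ : (π 0 = 0 ∧ π 1 = 1) ∨ (π 0 = 1 ∧ π 1 = 0) := by omega
  · left; rw [h0, h1]; rfl
  · right; rw [h0, h1]; rfl

theorem Induces.pairwise {T : LeafTree X} {o : T.TreeOrdering} {σ : Ranking X}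
    (h : T.Induces o σ) : (T.leafList o).Pairwise fun u v => σ u < σ v := by
  rw [h, List.pairwise_ofFn]
  intro i j hij
  simpa using hij

variable [DecidableEq X] {A B : Finset X}

/-- If an ordering lists sorted copies of `A` and `B` in this order, the inversions of the ranking
are the cross inversions. -/
theorem inversions_eq_crossInversions (hu : A ∪ B = Finset.univ) {ρ σ : Ranking X}
    {oA : (star A).TreeOrdering} {oB : (star B).TreeOrdering}
    (hA : ((star A).leafList oA).Pairwise fun u v => ρ u < ρ v)
    (hB : ((star B).leafList oB).Pairwise fun u v => ρ u < ρ v)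
    (h : ((star A).leafList oA ++ (star B).leafList oB).Pairwise fun u v => σ u < σ v) :
    inversions ρ σ = crossInversions ρ A B := by
  have hs : ∀ {l : List X}, l.Pairwise (fun u v => ρ u < ρ v) → l.Pairwise (fun u v => σ u < σ v) →
      ∀ u ∈ l, ∀ v ∈ l, ρ u < ρ v → σ u < σ v := by
    intro l h1 h2 u hu v hv
    -- The relation is made symmetric, so that it passes from pairs in list order to all pairs of
    -- members.
    have hS := (h1.and h2).imp (S := fun u v => (ρ u < ρ v → σ u < σ v) ∧ (ρ v < ρ u → σ v < σ u))
      fun h => ⟨fun _ => h.2, fun h' => absurd h' h.1.not_gt⟩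
    have : Std.Symm fun u v => (ρ u < ρ v → σ u < σ v) ∧ (ρ v < ρ u → σ v < σ u) :=
      ⟨fun _ _ h => ⟨h.2, h.1⟩⟩
    exact (hS.forall_of_forall (fun _ _ => by simp) hu hv).1
  rw [List.pairwise_append] at h
  obtain ⟨h1, h2, h3⟩ := h
  simp only [mem_leafList_star] at h3
  have hA' := hs hA h1
  have hB' := hs hB h2
  simp only [mem_leafList_star] at hA' hB'
  exact (inversions_le_crossInversions hu h3 hA' hB').antisymm (crossInversions_le_inversions h3)

/-- Inversion minimization on the Mann–Whitney tree is the Mann–Whitney statistic. -/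
theorem minInversions_mannWhitney (hd : Disjoint A B) (hu : A ∪ B = Finset.univ) (ρ : Ranking X) :
    (mannWhitney A B).minInversions ρ =
      min (crossInversions ρ A B) (crossInversions ρ B A) := by
  obtain ⟨oA, hA⟩ := exists_sorted_star A ρ
  obtain ⟨oB, hB⟩ := exists_sorted_star B ρ
  let o : (i : Fin 2) → ((![star A, star B] : Fin 2 → LeafTree X) i).TreeOrdering :=
    Fin.cons oA (Fin.cons oB finZeroElim)
  refine le_antisymm (le_min ?_ ?_) (le_csInf ?_ ?_)
  · obtain ⟨σ, hσ⟩ := exists_induces_mannWhitney hd hu (1, o)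
    refine Nat.sInf_le ⟨(1, o), σ, hσ, inversions_eq_crossInversions hu hA hB ?_⟩
    have e : (mannWhitney A B).leafList (1, o) =
      (star A).leafList oA ++ ((star B).leafList oB ++ []) := rfl
    rw [List.append_nil] at e
    exact e ▸ hσ.pairwise
  · obtain ⟨σ, hσ⟩ := exists_induces_mannWhitney hd hu (Equiv.swap 0 1, o)
    refine Nat.sInf_le ⟨(Equiv.swap 0 1, o), σ, hσ,
      inversions_eq_crossInversions (Finset.union_comm A B ▸ hu) hB hA ?_⟩
    have e : (mannWhitney A B).leafList (Equiv.swap 0 1, o) =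
      (star B).leafList oB ++ ((star A).leafList oA ++ []) := rfl
    rw [List.append_nil] at e
    exact e ▸ hσ.pairwise
  · obtain ⟨σ, hσ⟩ := exists_induces_mannWhitney hd hu (1, o)
    exact ⟨_, (1, o), σ, hσ, rfl⟩
  · rintro m ⟨o, σ, hσ, rfl⟩
    have hp := hσ.pairwise
    obtain ⟨oA, oB, e | e⟩ := leafList_mannWhitney A B o
    · rw [e, List.pairwise_append] at hp
      simp only [mem_leafList_star] at hp
      exact (min_le_left _ _).trans (crossInversions_le_inversions hp.2.2)
    · rw [e, List.pairwise_append] at hp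
      simp only [mem_leafList_star] at hp
      exact (min_le_right _ _).trans (crossInversions_le_inversions hp.2.2)

end LeafTree

/-! ### From the leaf count to the logarithmic bound -/

/-- The constant 1/4 loses one factor 2 in a + b ≤ 2b and another in log a ≤ 2 log(⌊a/2⌋ + 1); log 2
≤ 1 absorbs the change of base. -/
theorem mul_log_le_of_pow_le {a b q : ℕ} (ha : 1 ≤ a) (hab : a ≤ b)
    (h : (a / 2 + 1) ^ b ≤ 2 ^ q) :
    1 / 4 * (((a : ℝ) + (b : ℝ)) * Real.log (a : ℝ)) ≤ q := by
  have ha' : (0 : ℝ) < a := by exact_mod_cast ha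
  have hlog : 0 ≤ Real.log a := Real.log_natCast_nonneg a
  have hsq : (a : ℝ) ≤ ((a / 2 + 1 : ℕ) : ℝ) ^ 2 := by
    have : a ≤ (a / 2 + 1) ^ 2 := by nlinarith [Nat.div_add_mod a 2, Nat.mod_lt a two_pos]
    exact_mod_cast this
  have h1 : Real.log a ≤ 2 * Real.log ((a / 2 + 1 : ℕ) : ℝ) := by
    simpa using Real.log_le_log ha' hsq
  have h2 : (b : ℝ) * Real.log ((a / 2 + 1 : ℕ) : ℝ) ≤ q * Real.log 2 := by
    rw [← Real.log_pow, ← Real.log_pow]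
    exact Real.log_le_log (by positivity) (by exact_mod_cast h)
  have h3 : (q : ℝ) * Real.log 2 ≤ q :=
    mul_le_of_le_one_right (Nat.cast_nonneg q) (Real.log_two_lt_d9.le.trans (by norm_num))
  have h4 : (a : ℝ) * Real.log a ≤ b * Real.log a :=
    mul_le_mul_of_nonneg_right (by exact_mod_cast hab) hlog
  have h5 : (b : ℝ) * Real.log a ≤ b * (2 * Real.log ((a / 2 + 1 : ℕ) : ℝ)) :=
    mul_le_mul_of_nonneg_left h1 (Nat.cast_nonneg b)
  linarith

end ComparisonQuery

theorem mainTheorem4 :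
    ∃ c : ℝ, 0 < c ∧
      ∀ a b : ℕ, 1 ≤ a → a ≤ b →
        ∀ (X : Type*) [Fintype X] [DecidableEq X] (A B : Finset X),
          Disjoint A B → A ∪ B = Finset.univ → A.card = a → B.card = b →
            c * (((a : ℝ) + (b : ℝ)) * Real.log (a : ℝ)) ≤
                (ComparisonQuery.queryComplexity
                  (fun ρ : ComparisonQuery.Ranking X =>
                    ComparisonQuery.crossInversions ρ A B) : ℝ) ∧
            c * (((a : ℝ) + (b : ℝ)) * Real.log (a : ℝ)) ≤
                (ComparisonQuery.queryComplexity
                  (ComparisonQuery.LeafTree.mannWhitney A B).minInversions : ℝ) := by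
  refine ⟨1 / 4, by norm_num, ?_⟩
  rintro a b ha hab X _ _ A B hd hu rfl rfl
  -- For a = 1 the bound is 0.
  rcases ha.eq_or_lt with h1 | h1
  · simp [← h1]
  have hB : 2 ≤ B.card := le_trans h1 hab
  refine ⟨ComparisonQuery.mul_log_le_of_pow_le ha hab ?_,
    ComparisonQuery.mul_log_le_of_pow_le ha hab ?_⟩
  · refine ComparisonQuery.pow_le_two_pow_queryComplexity hd h1 hB _ fun ρ ρ' σ h h' _ => ?_
    omega
  · refine ComparisonQuery.pow_le_two_pow_queryComplexity hd h1 hB _ fun ρ ρ' σ h h' h'' => ?_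
    rw [ComparisonQuery.LeafTree.minInversions_mannWhitney hd hu,
      ComparisonQuery.LeafTree.minInversions_mannWhitney hd hu] at h' h''
    have e := ComparisonQuery.crossInversions_add_crossInversions hd ρ
    have e' := ComparisonQuery.crossInversions_add_crossInversions hd ρ'
    -- Equal minima at consecutive values c, c + 1 force ab = 2c + 1; the common value c is then the
    -- largest possible minimum, and `σ` attains it.
    rw [← e]
    exact ⟨⟨ComparisonQuery.crossInversions ρ A B, by omega⟩, by omega⟩
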